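/- Let $A$ be a finite alphabet and let $\mathbf z = z_0z_1z_2\cdots \in A^{\mathbb N}$ be an infinite word. Let $\mathrm{Fac}_n(\mathbf z)$ be the set of factors (blocks of consecutive letters) of $\mathbf z$ of length $n$; the word $\mathbf z$ is called Sturmian if $\#\mathrm{Fac}_n(\mathbf z) = n+1$ for all $n \ge 0$. For finite words $u = u_1\cdots u_m$ and $x$ over $A$, let $\binom{u}{x}$ be the number of sets of positions $i_1 < \cdots < i_{|x|}$ such that $u_{i_1}\cdots u_{i_{|x|}} = x$; write $u \sim_k v$ if $\binom{u}{x} = \binom{v}{x}$ for all words $x$ over $A$ of length at most $k$, and let $\mathrm b^{(k)}_{\mathbf z}(n) = \#\bigl(\mathrm{Fac}_n(\mathbf z)/{\sim_k}\bigr)$ be the $k$-binomial complexity of $\mathbf z$. Theorem. Let $k \ge 2$ be an integer. If $\mathrm b^{(k)}_{\mathbf z}(n) = n+1$ for all $n \ge 0$, then $\mathbf z$ is Sturmian. Conversely, if $\mathbf z$ is Sturmian, then $\mathrm b^{(k)}_{\mathbf z}(n) = n+1$ for all $n \ge 0$. Thus, for each single $k \ge 2$, Sturmian words are characterized by their $k$-binomial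 complexity. -/

import Mathlib

namespace InfWord

/-- The binomial coefficient of the finite words `u` and `w`: the number of times `w` occurs in `u`
as a (scattered) subword. The list `u.sublists'` has exactly one entry for each set of positions
`i₁ < i₂ < ⋯` of `u`, namely the subword read at these positions, so that counting the entries
equal to `w` counts the occurrences of `w` with multiplicity. -/
def binom {A : Type*} [DecidableEq A] (u w : List A) : ℕ :=
  u.sublists'.count w

/-- `u` and `v` are `k`-binomially equivalent: every word `x` of length at most `k` (over the
alphabet `A`) occurs as a subword equally often in `u` and in `v`. -/
def binomEquiv (A : Type*) [DecidableEq A] (k : ℕ) : Setoid (List A) where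
  r u v := ∀ x : List A, x.length ≤ k → binom u x = binom v x
  iseqv :=
    { refl := fun _ _ _ => rfl
      symm := fun h x hx => (h x hx).symm
      trans := fun h₁ h₂ x hx => (h₁ x hx).trans (h₂ x hx) }

/-- The factor `z i, z (i + 1), …, z (i + n - 1)` of length `n` of the infinite word `z`. -/
def window {A : Type*} (z : ℕ → A) (i n : ℕ) : List A :=
  List.ofFn fun j : Fin n => z (i + j)

/-- The set of factors of length `n` of the infinite word `z`. -/
def factors {A : Type*} (z : ℕ → A) (n : ℕ) : Set (List A) :=
  Set.range fun i => window z i n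

/-- The factor complexity of `z`: the number of factors of length `n`. -/
noncomputable def factorComplexity {A : Type*} (z : ℕ → A) (n : ℕ) : ℕ :=
  Nat.card (factors z n)

/-- The `k`-binomial complexity of `z`: the number of classes of factors of length `n` modulo
`k`-binomial equivalence. -/
noncomputable def binomComplexity {A : Type*} [DecidableEq A] (k : ℕ) (z : ℕ → A) (n : ℕ) : ℕ :=
  Nat.card (Quotient ((binomEquiv A k).comap (Subtype.val : factors z n → List A)))

/-- An infinite word is Sturmian if it has exactly `n + 1` factors of length `n`, for all `n`. -/
def IsSturmian {A : Type*} (z : ℕ → A) : Prop :=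
  ∀ n : ℕ, factorComplexity z n = n + 1

end InfWord

namespace InfWord

/-! ### Recursion for binomial coefficients of words. -/

section Binom

variable {A : Type*} [DecidableEq A]

/-! The binomial complexity never exceeds the factor complexity, so either side of the equivalence
yields at least n + 1 factors of every length n, and z is not eventually periodic. By induction it
is enough that, when there are m + 1 factors of each length m < n, 2-binomially equivalent factors
of length n coincide (`binomComplexity_eq_of_lt`). For n ≥ 2 the word is binary, and it is balanced
below length n (`balancedAt_of_factorComplexity`): a shortest unbalanced pair a s a, b s b has s a
palindrome, and around one of the two words the right special factor of length |s| + 1 is avoided so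
long that z becomes periodic. Balance keeps the difference of the prefix a-counts of two factors
from taking both signs, while the binomial coefficients of a, aa and ab make it sum to zero; hence
it vanishes (`window_eq_of_binom_eq`). -/

lemma binom_nil_right (u : List A) : binom u [] = 1 := by
  induction u with
  | nil => simp [binom]
  | cons c u ih =>
    have : (u.sublists'.map (List.cons c)).count [] = 0 := by
      rw [List.count_eq_zero]
      simp
    simp only [binom, List.sublists'_cons, List.count_append] at ih ⊢
    omega

lemma binom_nil_cons (e : A) (w : List A) : binom [] (e :: w) = 0 := by
  simp [binom]

lemma binom_cons_cons (c e : A) (u w : List A) :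
    binom (c :: u) (e :: w) = binom u (e :: w) + if c = e then binom u w else 0 := by
  simp only [binom, List.sublists'_cons, List.count_append, Nat.add_left_cancel_iff]
  split_ifs with h
  · subst h
    exact List.count_map_of_injective _ _ List.cons_injective _
  · rw [List.count_eq_zero]
    simp [h]

end Binom

/-! ### Factors, right special factors and eventual periodicity. -/

section Window

variable {A : Type*}

lemma window_zero (z : ℕ → A) (i : ℕ) : window z i 0 = [] := by
  simp [window]

lemma window_succ (z : ℕ → A) (i n : ℕ) : window z i (n + 1) = z i :: window z (i + 1) n := by
  simp [window, List.ofFn_succ, Nat.add_comm, Nat.add_left_comm]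

lemma window_eq_iff {z : ℕ → A} {x y n : ℕ} :
    window z x n = window z y n ↔ ∀ t < n, z (x + t) = z (y + t) := by
  simp only [window, List.ofFn_inj, funext_iff]
  exact ⟨fun h t ht => h ⟨t, ht⟩, fun h t => h t t.2⟩

lemma window_succ_eq_iff {z : ℕ → A} {x y n : ℕ} :
    window z x (n + 1) = window z y (n + 1) ↔
      window z x n = window z y n ∧ z (x + n) = z (y + n) := by
  simp only [window_eq_iff]
  refine ⟨fun h => ⟨fun t ht => h t (by omega), h n (by omega)⟩, fun h t ht => ?_⟩
  rcases Nat.lt_succ_iff_lt_or_eq.1 ht with h' | rfl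
  · exact h.1 t h'
  · exact h.2

lemma window_shift_eq {z : ℕ → A} {x y n : ℕ} (h : window z x n = window z y n)
    (hn : z (x + n) = z (y + n)) : window z (x + 1) n = window z (y + 1) n := by
  have := window_succ_eq_iff.2 ⟨h, hn⟩
  rw [window_succ, window_succ] at this
  exact (List.cons.inj this).2

lemma take_window (z : ℕ → A) (x n : ℕ) : (window z x (n + 1)).take n = window z x n := by
  apply List.ext_getElem
  · simp [window]
  · intro t _ _
    rw [List.getElem_take]
    simp only [window, List.getElem_ofFn]

lemma finite_factors [Finite A] (z : ℕ → A) (n : ℕ) : (factors z n).Finite := by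
  refine (List.finite_length_eq A n).subset ?_
  rintro _ ⟨i, rfl⟩
  simp [window]

lemma factorComplexity_eq_ncard (z : ℕ → A) (n : ℕ) :
    factorComplexity z n = (factors z n).ncard := rfl

/-- An eventually periodic word has bounded factor complexity. -/
lemma factorComplexity_le_of_periodic {z : ℕ → A} {N p : ℕ} (hp : 0 < p)
    (h : ∀ t, z (N + p + t) = z (N + t)) (n : ℕ) : factorComplexity z n ≤ N + p := by
  have key : ∀ x, ∃ y < N + p, window z x n = window z y n := by
    intro x
    induction x using Nat.strong_induction_on with
    | _ x ih =>
      by_cases hx : x < N + p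
      · exact ⟨x, hx, rfl⟩
      · obtain ⟨y, hy, hxy⟩ := ih (x - p) (by omega)
        refine ⟨y, hy, Eq.trans ?_ hxy⟩
        rw [window_eq_iff]
        intro t _
        have := h (x - p - N + t)
        rwa [show N + p + (x - p - N + t) = x + t by omega,
          show N + (x - p - N + t) = x - p + t by omega] at this
  have hsub : factors z n ⊆ (fun y => window z y n) '' (Finset.range (N + p) : Set ℕ) := by
    rintro _ ⟨x, rfl⟩
    obtain ⟨y, hy, hxy⟩ := key x
    exact ⟨y, by simpa using hy, hxy.symm⟩
  calc factorComplexity z n ≤ _ := Set.ncard_le_ncard hsub (Set.toFinite _)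
    _ ≤ (Finset.range (N + p) : Set ℕ).ncard := Set.ncard_image_le (Set.toFinite _)
    _ = N + p := by rw [Set.ncard_coe_finset, Finset.card_range]

/-- If the word revisits a factor of length `L` and no factor of length `L` in between is right
special, then it is eventually periodic. -/
lemma eventually_periodic_of_not_special {z : ℕ → A} {x p L : ℕ} (hp : 0 < p)
    (hx : window z x L = window z (x + p) L)
    (hns : ∀ t < p, ∀ y, window z y L = window z (x + t) L → z (y + L) = z (x + t + L)) (r : ℕ) :
    window z (x + p + r) L = window z (x + r) L := by
  have key : ∀ r, ∃ t < p, window z (x + r) L = window z (x + t) L := by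
    intro r
    induction r with
    | zero => exact ⟨0, hp, rfl⟩
    | succ r ih =>
      obtain ⟨t, ht, h⟩ := ih
      have h' : window z (x + r + 1) L = window z (x + t + 1) L :=
        window_shift_eq h (hns t ht _ h)
      by_cases htp : t + 1 < p
      · exact ⟨t + 1, htp, h'⟩
      · refine ⟨0, hp, h'.trans ?_⟩
        rw [show x + t + 1 = x + p by omega]
        exact hx.symm
  induction r with
  | zero => exact hx.symm
  | succ r ih =>
    obtain ⟨t, ht, h⟩ := key r
    exact window_shift_eq ih ((hns t ht _ (ih.trans h)).trans (hns t ht _ h).symm)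

/-- There is at most one right special factor of length `l` when the complexity grows by at most
one. -/
lemma right_special_unique [Finite A] {z : ℕ → A} {l : ℕ}
    (hl : factorComplexity z (l + 1) ≤ factorComplexity z l + 1) {x y x' y' : ℕ}
    (h : window z x l = window z y l) (hne : z (x + l) ≠ z (y + l))
    (h' : window z x' l = window z y' l) (hne' : z (x' + l) ≠ z (y' + l)) :
    window z x l = window z x' l := by
  by_contra hxx
  set X := window z x (l + 1)
  set X' := window z x' (l + 1)
  have hXX : X' ≠ X := fun e => hxx (window_succ_eq_iff.1 e).1.symm
  -- Each of the two right special factors keeps another extension once X and X' are removed, so the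
  -- complexity would grow by at least two.
  have hsub : factors z l ⊆ (List.take l) '' ((factors z (l + 1) \ {X}) \ {X'}) := by
    rintro _ ⟨q, rfl⟩
    by_cases h1 : window z q (l + 1) = X
    · refine ⟨window z y (l + 1), ⟨⟨⟨y, rfl⟩, ?_⟩, ?_⟩, ?_⟩
      · exact fun e => hne (window_succ_eq_iff.1 e).2.symm
      · exact fun e => hxx (h.trans (window_succ_eq_iff.1 e).1)
      · rw [take_window, ← h]
        exact (window_succ_eq_iff.1 h1).1.symm
    by_cases h2 : window z q (l + 1) = X'
    · refine ⟨window z y' (l + 1), ⟨⟨⟨y', rfl⟩, ?_⟩, ?_⟩, ?_⟩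
      · exact fun e => hxx (h'.trans (window_succ_eq_iff.1 e).1).symm
      · exact fun e => hne' (window_succ_eq_iff.1 e).2.symm
      · rw [take_window, ← h']
        exact (window_succ_eq_iff.1 h2).1.symm
    · exact ⟨window z q (l + 1), ⟨⟨⟨q, rfl⟩, h1⟩, h2⟩, take_window z q l⟩
  have hfin := finite_factors z (l + 1)
  have hfin2 : ((factors z (l + 1) \ {X}) \ {X'}).Finite := hfin.sdiff.sdiff
  have c1 := Set.ncard_le_ncard hsub (hfin2.image _)
  have c2 := Set.ncard_image_le (f := List.take l) hfin2
  have c3 := Set.ncard_sdiff_singleton_add_one (s := factors z (l + 1)) (a := X) ⟨x, rfl⟩ hfin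
  have c4 := Set.ncard_sdiff_singleton_add_one (s := factors z (l + 1) \ {X}) (a := X')
    ⟨⟨x', rfl⟩, hXX⟩ hfin.sdiff
  rw [factorComplexity_eq_ncard, factorComplexity_eq_ncard] at hl
  omega

/-- Otherwise dropping the last letter is injective on factors of length l + 1. -/
lemma exists_right_special [Finite A] {z : ℕ → A} {l : ℕ}
    (hl : factorComplexity z l < factorComplexity z (l + 1)) :
    ∃ x y, window z x l = window z y l ∧ z (x + l) ≠ z (y + l) := by
  by_contra! hcon
  refine hl.not_ge (Set.ncard_le_ncard_of_injOn (List.take l) ?_ ?_ (finite_factors z l))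
  · rintro _ ⟨x, rfl⟩
    exact ⟨x, (take_window z x l).symm⟩
  · rintro _ ⟨x, rfl⟩ _ ⟨y, rfl⟩ e
    simp only [take_window] at e
    exact window_succ_eq_iff.2 ⟨e, hcon x y e⟩

/-- If `a s a` occurs at position `i`, with `s` a palindrome of length `l`, then the only right
special factor of length `l + 1` is not `c s` with `c ≠ a`, unless the complexity is bounded. -/
lemma false_of_palindrome [Finite A] {z : ℕ → A} {i q l : ℕ}
    (hlow : ∀ n, n + 1 ≤ factorComplexity z n)
    (hl : factorComplexity z (l + 1) = l + 2)
    (hpal : ∀ t < l, z (i + 1 + t) = z (i + l - t))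
    (hlast : z (i + l + 1) = z i)
    (hq : z q ≠ z i) (hs : ∀ t < l, z (q + 1 + t) = z (i + 1 + t))
    (huniq : ∀ x y, window z x (l + 1) = window z y (l + 1) → z (x + (l + 1)) ≠ z (y + (l + 1)) →
      window z x (l + 1) = window z q (l + 1)) : False := by
  -- If c s with c = `z q` began at i + t, 1 ≤ t ≤ l, the letter of s falling on position i + l + 1
  -- would be the mirror image of `z (i + t)`, hence c; but that position carries `z i`.
  have havoid : ∀ t < l + 2, window z (i + t) (l + 1) ≠ window z q (l + 1) := by
    intro t ht e
    rw [window_eq_iff] at e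
    have h0 : z (i + t) = z q := e 0 (by omega)
    rcases Nat.eq_zero_or_pos t with rfl | ht0
    · exact hq h0.symm
    rcases Nat.lt_succ_iff_lt_or_eq.1 ht with ht1 | rfl
    · have h1 := hpal (t - 1) (by omega)
      have h2 := e (l + 1 - t) (by omega)
      rw [show i + 1 + (t - 1) = i + t by omega, show i + l - (t - 1) = i + (l + 1 - t) by omega]
        at h1
      rw [show i + t + (l + 1 - t) = i + l + 1 by omega] at h2
      have h3 := hs (l - t) (by omega)
      rw [show q + 1 + (l - t) = q + (l + 1 - t) by omega,
        show i + 1 + (l - t) = i + (l + 1 - t) by omega] at h3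
      exact hq (by rw [← h0, h1, ← h3, ← h2, hlast])
    · exact hq (h0.symm.trans hlast)
  have hns : ∀ t < l + 2, ∀ y, window z y (l + 1) = window z (i + t) (l + 1) →
      z (y + (l + 1)) = z (i + t + (l + 1)) := by
    intro t ht y hy
    by_contra hne
    exact havoid t ht (hy.symm.trans (huniq y _ hy hne))
  -- Only l + 1 factors remain for l + 2 positions, so one is repeated with no right special factor
  -- in between.
  have hcard : (factors z (l + 1) \ {window z q (l + 1)}).ncard <
      (Finset.range (l + 2) : Set ℕ).ncard := by
    have := Set.ncard_sdiff_singleton_add_one (s := factors z (l + 1)) (a := window z q (l + 1))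
      ⟨q, rfl⟩ (finite_factors z _)
    rw [factorComplexity_eq_ncard] at hl
    rw [Set.ncard_coe_finset, Finset.card_range]
    omega
  obtain ⟨t₁, ht₁, t₂, ht₂, hne, heq⟩ := Set.exists_ne_map_eq_of_ncard_lt_of_maps_to hcard
    (f := fun t => window z (i + t) (l + 1))
    (fun t ht => ⟨⟨_, rfl⟩, havoid t (by simpa using ht)⟩) (finite_factors z _).sdiff
  simp only [Finset.coe_range, Set.mem_Iio] at ht₁ ht₂ heq
  wlog hlt : t₁ < t₂ generalizing t₁ t₂
  · apply this t₂ t₁ <;> first | assumption | exact hne.symm | exact heq.symm | omega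
  have hper := eventually_periodic_of_not_special (z := z) (x := i + t₁) (p := t₂ - t₁)
    (L := l + 1) (by omega) (by rwa [show i + t₁ + (t₂ - t₁) = i + t₂ by omega])
    (fun t ht y hy => by
      rw [Nat.add_assoc i t₁ t] at hy ⊢
      exact hns (t₁ + t) (by omega) y hy)
  have hbound := factorComplexity_le_of_periodic (z := z) (N := i + t₁) (p := t₂ - t₁) (by omega)
    (fun t => window_eq_iff.1 (hper t) 0 (by omega)) (i + t₁ + (t₂ - t₁))
  have := hlow (i + t₁ + (t₂ - t₁))
  omega

lemma exists_two_letters [Finite A] {z : ℕ → A} (h : factorComplexity z 1 = 2) :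
    ∃ a b, a ≠ b ∧ ∀ i, z i = a ∨ z i = b := by
  obtain ⟨u, v, huv, he⟩ := Set.ncard_eq_two.1 h
  obtain ⟨x, rfl⟩ : u ∈ factors z 1 := by simp [he]
  obtain ⟨y, rfl⟩ : v ∈ factors z 1 := by simp [he]
  refine ⟨z x, z y, fun e => huv (by simp [window_succ, window_zero, e]), fun i => ?_⟩
  have : window z i 1 ∈ factors z 1 := ⟨i, rfl⟩
  rw [he] at this
  simpa [window_succ, window_zero] using this

end Window

/-! ### Balance of words of Sturmian complexity. -/

section Balance

variable {A : Type*} [DecidableEq A]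

/-- The number of occurrences of the letter `a` in the factor of length `m` at position `i`. -/
def letterCount (z : ℕ → A) (a : A) (i m : ℕ) : ℤ :=
  ∑ j ∈ Finset.range m, if z (i + j) = a then 1 else 0

variable {z : ℕ → A} {a b : A}

lemma letterCount_zero (i : ℕ) : letterCount z a i 0 = 0 := by
  simp [letterCount]

lemma letterCount_succ (i m : ℕ) :
    letterCount z a i (m + 1) = letterCount z a i m + if z (i + m) = a then 1 else 0 := by
  rw [letterCount, Finset.sum_range_succ, letterCount]

lemma letterCount_add (i m n : ℕ) :
    letterCount z a i (m + n) = letterCount z a i m + letterCount z a (i + m) n := by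
  simp only [letterCount, Finset.sum_range_add, Nat.add_assoc]

lemma letterCount_succ' (i m : ℕ) :
    letterCount z a i (m + 1) = (if z i = a then 1 else 0) + letterCount z a (i + 1) m := by
  rw [Nat.add_comm m 1, letterCount_add, letterCount_succ, letterCount_zero, zero_add, Nat.add_zero]

lemma eq_of_indicator_eq (hab : ∀ i, z i = a ∨ z i = b) {x y : ℕ}
    (h : (if z x = a then (1 : ℤ) else 0) = if z y = a then 1 else 0) : z x = z y := by
  rcases hab x with hx | hx <;> rcases hab y with hy | hy <;> split_ifs at h <;> simp_all

lemma eq_of_letterCount_eq (hab : ∀ i, z i = a ∨ z i = b) {x y n : ℕ} {c : ℤ}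
    (h : ∀ l ≤ n, letterCount z a x l = letterCount z a y l + c) :
    ∀ t < n, z (x + t) = z (y + t) := by
  intro t ht
  have h1 := h (t + 1) ht
  have h0 := h t ht.le
  rw [letterCount_succ, letterCount_succ] at h1
  exact eq_of_indicator_eq hab (by linarith)

/-- All factors of length `m` contain the letter `a` equally often, up to one. -/
def BalancedAt (z : ℕ → A) (a : A) (m : ℕ) : Prop :=
  ∀ i j, letterCount z a i m ≤ letterCount z a j m + 1

/-- A shortest unbalanced pair of factors has the form `a s a`, `b s b` with a palindrome `s`. -/
lemma exists_palindrome_of_unbalanced (hab : ∀ i, z i = a ∨ z i = b) {m : ℕ}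
    (hmin : ∀ l < m, BalancedAt z a l) (hm : ¬ BalancedAt z a m) :
    ∃ l i j, m = l + 2 ∧ z i = a ∧ z (i + l + 1) = a ∧ z j ≠ a ∧ z (j + l + 1) ≠ a ∧
      (∀ t < l, z (i + 1 + t) = z (j + 1 + t)) ∧
      (∀ t < l, z (i + 1 + t) = z (i + l - t)) := by
  simp only [BalancedAt, not_forall, not_le] at hm
  obtain ⟨i, j, hij⟩ := hm
  obtain ⟨l, rfl⟩ : ∃ l, m = l + 2 := by
    rcases m with _ | _ | l
    · simp [letterCount_zero] at hij
    · simp only [letterCount_succ, letterCount_zero] at hij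
      split_ifs at hij <;> omega
    · exact ⟨l, rfl⟩
  -- The excess is at least 2 in total and, by minimality, at most 1 on each of the two pieces cut
  -- at r.
  have hone : ∀ r, 1 ≤ r → r ≤ l + 1 → letterCount z a i r = letterCount z a j r + 1 := by
    intro r h1 h2
    have e1 := hmin r (by omega) i j
    have e2 := hmin (l + 2 - r) (by omega) (i + r) (j + r)
    have e3 := letterCount_add (z := z) (a := a) i r (l + 2 - r)
    have e4 := letterCount_add (z := z) (a := a) j r (l + 2 - r)
    rw [show r + (l + 2 - r) = l + 2 by omega] at e3 e4
    linarith
  have hi : z i = a ∧ z j ≠ a := by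
    have := hone 1 le_rfl (by omega)
    simp only [letterCount_succ, letterCount_zero, Nat.add_zero] at this
    split_ifs at this <;> simp_all
  have hi' : z (i + l + 1) = a ∧ z (j + l + 1) ≠ a := by
    have := hone (l + 1) (by omega) (by omega)
    rw [letterCount_succ i (l + 1), letterCount_succ j (l + 1)] at hij
    rw [← Nat.add_assoc, ← Nat.add_assoc] at hij
    split_ifs at hij <;> first | (exfalso; linarith) | simp_all
  have hmid : ∀ r ≤ l, letterCount z a (i + 1) r = letterCount z a (j + 1) r := by
    intro r hr
    have := hone (r + 1) (by omega) (by omega)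
    rw [letterCount_succ', letterCount_succ', if_pos hi.1, if_neg hi.2] at this
    linarith
  have heq : ∀ t < l, z (i + 1 + t) = z (j + 1 + t) :=
    eq_of_letterCount_eq hab (c := 0) (by simpa using hmid)
  have hsuf : ∀ r ≤ l, letterCount z a (i + (l + 1 - r)) r = letterCount z a (j + (l + 1 - r)) r := by
    intro r hr
    have e3 := letterCount_add (z := z) (a := a) i (l + 1 - r) r
    have e4 := letterCount_add (z := z) (a := a) j (l + 1 - r) r
    rw [show l + 1 - r + r = l + 1 by omega] at e3 e4
    have e5 := hone (l + 1) (by omega) le_rfl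
    have e6 := hone (l + 1 - r) (by omega) (by omega)
    linarith
  -- Balance is applied to a·prefix against suffix·b and to suffix·a against b·prefix, for the
  -- prefix and suffix of s of length r.
  have hpal : ∀ r ≤ l, letterCount z a (i + 1) r = letterCount z a (i + (l + 1 - r)) r := by
    intro r hr
    have e1 := hmin (r + 1) (by omega) i (j + (l + 1 - r))
    have e2 := hmin (r + 1) (by omega) (i + (l + 1 - r)) j
    rw [letterCount_succ', letterCount_succ _ r, if_pos hi.1,
      show j + (l + 1 - r) + r = j + l + 1 by omega, if_neg hi'.2] at e1
    rw [letterCount_succ' j, letterCount_succ _ r, if_neg hi.2,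
      show i + (l + 1 - r) + r = i + l + 1 by omega, if_pos hi'.1] at e2
    have e3 := hsuf r hr
    have e4 := hmid r hr
    linarith
  refine ⟨l, i, j, rfl, hi.1, hi'.1, hi.2, hi'.2, heq, fun t ht => ?_⟩
  have h0 := hpal t (by omega)
  have h1 := hpal (t + 1) (by omega)
  rw [letterCount_succ, letterCount_succ', show i + (l + 1 - (t + 1)) = i + l - t by omega,
    show i + l - t + 1 = i + (l + 1 - t) by omega] at h1
  exact eq_of_indicator_eq hab (by linarith)

/-- The factors of length `m` are balanced if the complexity is that of a Sturmian word up to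
length `m`, and the word is not eventually periodic. -/
lemma balancedAt_of_factorComplexity [Finite A] (hab : ∀ i, z i = a ∨ z i = b)
    (hlow : ∀ n, n + 1 ≤ factorComplexity z n) (m : ℕ)
    (hm : ∀ l ≤ m, factorComplexity z l = l + 1) : BalancedAt z a m := by
  induction m using Nat.strong_induction_on with
  | _ m ih =>
    by_contra hun
    obtain ⟨l, i, j, rfl, hi, hi', hj, hj', heq, hpal⟩ := exists_palindrome_of_unbalanced hab
      (fun l hl => ih l hl fun r hr => hm r (by omega)) hun
    have c0 := hm l (by omega)
    have c1 := hm (l + 1) (by omega)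
    have c2 : factorComplexity z (l + 1 + 1) = l + 2 + 1 := hm (l + 2) le_rfl
    obtain ⟨q, q', hqq, hqne⟩ := exists_right_special (z := z) (l := l + 1) (by omega)
    -- Both this suffix and s are right special of length l, so the right special factor of length l
    -- + 1 is c s.
    have hqi : window z (q + 1) l = window z (i + 1) l := by
      refine right_special_unique (z := z) (l := l) (by omega) (y := q' + 1) (y' := j + 1) ?_ ?_
        (window_eq_iff.2 heq) ?_
      · rw [window_succ, window_succ] at hqq
        exact (List.cons.inj hqq).2
      · rwa [show q + 1 + l = q + (l + 1) by omega, show q' + 1 + l = q' + (l + 1) by omega]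
      · rw [show i + 1 + l = i + l + 1 by omega, show j + 1 + l = j + l + 1 by omega, hi']
        exact hj'.symm
    rw [window_eq_iff] at hqi
    have huniq : ∀ x y, window z x (l + 1) = window z y (l + 1) →
        z (x + (l + 1)) ≠ z (y + (l + 1)) → window z x (l + 1) = window z q (l + 1) :=
      fun x y h hne => right_special_unique (by omega) h hne hqq hqne
    -- The contradiction comes from whichever of a s a, b s b does not start with c.
    by_cases hqa : z q = a
    · refine false_of_palindrome (i := j) hlow c1 (fun t ht => ?_) ?_ ?_
        (fun t ht => (hqi t ht).trans (heq t ht)) huniq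
      · have e := heq (l - 1 - t) (by omega)
        rw [show i + 1 + (l - 1 - t) = i + l - t by omega,
          show j + 1 + (l - 1 - t) = j + l - t by omega] at e
        rw [← heq t ht, hpal t ht, e]
      · have h1 := hab j
        have h2 := hab (j + l + 1)
        simp_all
      · rw [hqa]
        exact hj.symm
    · exact false_of_palindrome (i := i) hlow c1 hpal (hi'.trans hi.symm) (by rwa [hi]) hqi huniq

/-! ### Separation of balanced factors by 2-binomial equivalence. -/

lemma binom_window_singleton (x n : ℕ) :
    (binom (window z x n) [a] : ℤ) = letterCount z a x n := by
  induction n generalizing x with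
  | zero => simp [window_zero, binom_nil_cons, letterCount_zero]
  | succ n ih =>
    rw [window_succ, binom_cons_cons, binom_nil_right, letterCount_succ', ← ih]
    push_cast
    ring

lemma letterCount_add_letterCount (hab : ∀ i, z i = a ∨ z i = b) (hne : a ≠ b) (x n : ℕ) :
    letterCount z a x n + letterCount z b x n = n := by
  induction n with
  | zero => simp [letterCount_zero]
  | succ n ih =>
    have : ((if z (x + n) = a then 1 else 0) + if z (x + n) = b then 1 else 0 : ℤ) = 1 := by
      rcases hab (x + n) with h | h <;> simp [h, hne, hne.symm]
    rw [letterCount_succ, letterCount_succ]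
    push_cast
    linarith

/-- Both sides count pairs of positions whose first letter is a; the right side groups them by the
second position. -/
lemma binom_window_pair (hab : ∀ i, z i = a ∨ z i = b) (hne : a ≠ b) (x n : ℕ) :
    (binom (window z x n) [a, a] + binom (window z x n) [a, b] : ℤ) =
      ∑ l ∈ Finset.range n, letterCount z a x l := by
  induction n generalizing x with
  | zero => simp [window_zero, binom_nil_cons]
  | succ n ih =>
    rw [window_succ, binom_cons_cons, binom_cons_cons, Finset.sum_range_succ']
    simp only [letterCount_succ', letterCount_zero, Finset.sum_add_distrib, ← ih]
    have := letterCount_add_letterCount hab hne (x + 1) n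
    rw [← binom_window_singleton, ← binom_window_singleton] at this
    split_ifs
    · push_cast
      simp
      linarith
    · simp

/-- If all shorter factors are balanced, then `2`-binomially equivalent factors of the same length
are equal. -/
lemma window_eq_of_binom_eq (hab : ∀ i, z i = a ∨ z i = b) (hne : a ≠ b) {n x y : ℕ}
    (hbal : ∀ l < n, BalancedAt z a l)
    (h : ∀ w : List A, w.length ≤ 2 → binom (window z x n) w = binom (window z y n) w) :
    window z x n = window z y n := by
  have htot : letterCount z a x n = letterCount z a y n := by
    rw [← binom_window_singleton, ← binom_window_singleton, h [a] (by simp)]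
  have hsum : ∑ l ∈ Finset.range n, (letterCount z a x l - letterCount z a y l) = 0 := by
    rw [Finset.sum_sub_distrib, ← binom_window_pair hab hne, ← binom_window_pair hab hne,
      h [a, a] (by simp), h [a, b] (by simp), sub_self]
  have hdiff : ∀ u v, u ≤ n → v ≤ n → letterCount z a x v - letterCount z a y v ≤
      letterCount z a x u - letterCount z a y u + 1 := by
    intro u v hu hv
    rcases le_total u v with huv | huv
    · obtain ⟨d, rfl⟩ := Nat.exists_eq_add_of_le huv
      rcases Nat.lt_or_ge d n with hd | hd
      · have := hbal d hd (x + u) (y + u)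
        rw [letterCount_add, letterCount_add]
        linarith
      -- Balance is not assumed at the full length n; equality of the total a-counts replaces it.
      · obtain ⟨rfl, rfl⟩ : u = 0 ∧ d = n := by omega
        simp [letterCount_zero, htot]
    · obtain ⟨d, rfl⟩ := Nat.exists_eq_add_of_le huv
      rcases Nat.lt_or_ge d n with hd | hd
      · have := hbal d hd (y + v) (x + v)
        rw [letterCount_add, letterCount_add]
        linarith
      · obtain ⟨rfl, rfl⟩ : v = 0 ∧ d = n := by omega
        simp [letterCount_zero, htot]
  have hzero : ∀ l ∈ Finset.range n, letterCount z a x l - letterCount z a y l = 0 := by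
    -- Values of the difference are integers at most 1 apart, so a negative one excludes positive
    -- ones.
    by_cases hneg : ∃ u < n, letterCount z a x u - letterCount z a y u < 0
    · obtain ⟨u, hu, hu'⟩ := hneg
      refine (Finset.sum_eq_zero_iff_of_nonpos fun v hv => ?_).1 hsum
      have := hdiff u v hu.le (Finset.mem_range.1 hv).le
      linarith
    · push Not at hneg
      exact (Finset.sum_eq_zero_iff_of_nonneg fun v hv => hneg v (Finset.mem_range.1 hv)).1 hsum
  refine window_eq_iff.2 (eq_of_letterCount_eq hab (c := 0) fun l hl => ?_)
  rcases hl.lt_or_eq with hl | rfl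
  · linarith [hzero l (Finset.mem_range.2 hl)]
  · linarith

end Balance

/-! ### Comparison of the two complexities. -/

section Complexity

variable {A : Type*} [DecidableEq A]

lemma binomComplexity_le_factorComplexity [Finite A] (k : ℕ) (z : ℕ → A) (n : ℕ) :
    binomComplexity k z n ≤ factorComplexity z n := by
  have : Finite (factors z n) := finite_factors z n
  exact Nat.card_le_card_of_surjective _ Quotient.mk_surjective

lemma binomComplexity_eq_factorComplexity {k : ℕ} {z : ℕ → A} {n : ℕ}
    (h : ∀ x y, (∀ w : List A, w.length ≤ k → binom (window z x n) w = binom (window z y n) w) →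
      window z x n = window z y n) :
    binomComplexity k z n = factorComplexity z n := by
  refine (Nat.card_congr (Equiv.ofBijective (Quotient.mk _) ⟨?_, Quotient.mk_surjective⟩)).symm
  rintro ⟨_, x, rfl⟩ ⟨_, y, rfl⟩ e
  exact Subtype.ext (h x y (Quotient.exact e))

/-- If the complexity is that of a Sturmian word at all lengths below `n`, and the word is not
eventually periodic, then the factors of length `n` are pairwise not `k`-binomially equivalent. -/
lemma binomComplexity_eq_of_lt [Finite A] {k : ℕ} (hk : 2 ≤ k) {z : ℕ → A}
    (hlow : ∀ n, n + 1 ≤ factorComplexity z n) {n : ℕ}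
    (hn : ∀ m < n, factorComplexity z m = m + 1) :
    binomComplexity k z n = factorComplexity z n := by
  refine binomComplexity_eq_factorComplexity fun x y h => ?_
  rcases Nat.lt_or_ge 1 n with h1 | h1
  · obtain ⟨a, b, hne, hab⟩ := exists_two_letters (hn 1 h1)
    exact window_eq_of_binom_eq hab hne
      (fun l hl => balancedAt_of_factorComplexity hab hlow l fun r hr => hn r (by omega))
      fun w hw => h w (hw.trans hk)
  -- For n = 1 the word is not yet known to be binary; single-letter counts suffice.
  · interval_cases n
    · simp [window_zero]
    · have := h [z x] (by simp; omega)
      simp only [window_succ, window_zero, binom_cons_cons, binom_nil_cons, binom_nil_right] at this ⊢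
      split_ifs at this with e1 e2 <;> simp_all

end Complexity

end InfWord

theorem mainTheorem2 {A : Type*} [Finite A] [DecidableEq A] (z : ℕ → A) (k : ℕ) (hk : 2 ≤ k) :
    (∀ n : ℕ, InfWord.binomComplexity k z n = n + 1) ↔ InfWord.IsSturmian z := by
  constructor
  · intro h n
    have hlow : ∀ n, n + 1 ≤ InfWord.factorComplexity z n := fun n =>
      (h n).symm.le.trans (InfWord.binomComplexity_le_factorComplexity k z n)
    induction n using Nat.strong_induction_on with
    | _ n ih => rw [← InfWord.binomComplexity_eq_of_lt hk hlow ih, h n]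
  · intro h n
    rw [InfWord.binomComplexity_eq_of_lt hk (fun m => (h m).ge) fun m _ => h m, h n]
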